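/- Let $X$ be a connected and locally path connected topological space (for instance a connected finite simplicial complex) and let $\mathcal H$ be a separable complex Hilbert space. For each $x\in X$ let $D_x$ be a closed, self-adjoint, possibly unbounded operator on $\mathcal H$ such that $(I+D_x^2)^{-1}$ is compact and $D_x$ has infinitely many positive and infinitely many negative eigenvalues. Assume that the family $\{D_x\}$ is continuous in the sense that $(f,x)\mapsto f(D_x)$ is norm continuous on $C_b(\mathbb R)\times X$, where $C_b(\mathbb R)$ is the space of bounded continuous functions $\mathbb R\to\mathbb C$ having limits at $\pm\infty$, with the supremum norm. Let $m(D_x,\lambda)$ be the dimension of the eigenspace of $D_x$ for $\lambda$, and let $$\Gamma=\{(x,\lambda)\in X\times\mathbb R : \lambda \text{ is an eigenvalue of } D_x\}$$ be the spectral graph. A *spectral exhaustion* of the family is a sequence of continuous functions $\mu_n:X\to\mathbb R$, $n\in\mathbb Z$, such that for every $x$: each $\mu_n(x)$ is an eigenvalue of $D_x$; each eigenvalue $\lambda$ of $D_x$ equals $\mu_n(x)$ for exactly $m(D_x,\lambda)$ indices $n$; and $\mu_n(x)\le\mu_{n+1}(x)$ for all $n$. Spectral exhaustions exist locally: there are an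 open cover $\{V_i\}$ of $X$ and spectral exhaustions $(\mu_{n,i})_n$ of the family over $V_i$. On each overlap two of them differ by a translation of the index, $\mu_{n,i}(x)=\mu_{n+\nu_{ij}(x),\,j}(x)$ for all $n$, with $\nu_{ij}:V_i\cap V_j\to\mathbb Z$ locally constant. The $\nu_{ij}$ form a Čech 1-cocycle, whose class in $\check H^1(X,\mathbb Z)$ is the *spectral flow* $\mathrm{sf}(\{D_x\})$. **Theorem.** Suppose that there is an integer $k$ with $m(D_x,\lambda)=k$ for every $(x,\lambda)\in\Gamma$, and that $\mathrm{sf}(\{D_x\})=0$. Then there is a spectral exhaustion $(\mu_n)_{n\in\mathbb Z}$ of the family whose functions have pairwise disjoint graphs except for repetitions due to multiplicity: for all $m,n$, either $\mu_m=\mu_n$ or the graphs of $\mu_m$ and $\mu_n$ in $X\times\mathbb R$ are disjoint, and for each $n$ there are exactly $k$ indices $m$ with $\mu_m=\mu_n$. Moreover, the projection $X\times\mathbb R\to X$ restricts to a homeomorphism from each connected component of $\Gamma$ onto $X$. -/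

import Mathlib

open TopologicalSpace Topology Filter
open scoped BoundedContinuousFunction

noncomputable section

namespace SpectralFamily

universe u v

/-! ## First Čech cohomology with integer coefficients -/

section Cech

variable {X : Type u} [TopologicalSpace X]

/-- An open cover of `X` indexed by the points of `X`, the set indexed by `p` being an open
neighbourhood of `p`. Every open cover is refined by one of this form, and two refinement maps
between covers induce the same map on Čech cohomology, so that these covers, ordered by pointwise
reverse inclusion, compute the colimit that defines Čech cohomology. -/
@[ext]
structure PointedCover (X : Type u) [TopologicalSpace X] where
  nhd : X → Opens X
  mem_nhd : ∀ p, p ∈ nhd p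

/-- `U ≤ V` means that `V` is finer than `U`. -/
instance : PartialOrder (PointedCover X) where
  le U V := ∀ p, V.nhd p ≤ U.nhd p
  le_refl _ _ := le_rfl
  le_trans _ _ _ h₁ h₂ p := (h₂ p).trans (h₁ p)
  le_antisymm _ _ h₁ h₂ := PointedCover.ext (funext fun p => le_antisymm (h₂ p) (h₁ p))

instance : IsDirectedOrder (PointedCover X) where
  directed U V :=
    ⟨⟨fun p => U.nhd p ⊓ V.nhd p, fun p => ⟨U.mem_nhd p, V.mem_nhd p⟩⟩,
      fun _ => inf_le_left, fun _ => inf_le_right⟩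

/-- Restriction of integer-valued locally constant functions to a smaller open set. -/
def res {V U : Opens X} (h : V ≤ U) : LocallyConstant U ℤ →+ LocallyConstant V ℤ :=
  LocallyConstant.comapAddMonoidHom ⟨Set.inclusion h, continuous_inclusion h⟩

@[simp]
theorem res_apply {V U : Opens X} (h : V ≤ U) (f : LocallyConstant U ℤ) (x : V) :
    res h f x = f ⟨x, h x.2⟩ := rfl

/-- Čech cochains of degree 0, 1, 2. -/
abbrev C0 (U : PointedCover X) : Type u := ∀ p, LocallyConstant (U.nhd p) ℤ

abbrev C1 (U : PointedCover X) : Type u := ∀ p q, LocallyConstant ↥(U.nhd p ⊓ U.nhd q) ℤ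

abbrev C2 (U : PointedCover X) : Type u :=
  ∀ p q r, LocallyConstant ↥(U.nhd p ⊓ U.nhd q ⊓ U.nhd r) ℤ

/-- `(d g) p q = g q - g p`. -/
def d0 (U : PointedCover X) : C0 U →+ C1 U where
  toFun g p q := res inf_le_right (g q) - res inf_le_left (g p)
  map_zero' := by funext p q; ext x; simp
  map_add' f g := by
    funext p q; ext x
    simp only [Pi.add_apply, map_add, LocallyConstant.sub_apply, LocallyConstant.add_apply]
    ring

/-- `(d c) p q r = c q r - c p r + c p q`. -/
def d1 (U : PointedCover X) : C1 U →+ C2 U where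
  toFun c p q r :=
    res (le_inf (inf_le_left.trans inf_le_right) inf_le_right) (c q r)
      - res (le_inf (inf_le_left.trans inf_le_left) inf_le_right) (c p r)
      + res inf_le_left (c p q)
  map_zero' := by funext p q r; ext x; simp
  map_add' f g := by
    funext p q r; ext x
    simp only [Pi.add_apply, map_add, LocallyConstant.sub_apply, LocallyConstant.add_apply]
    ring

theorem d1_d0 (U : PointedCover X) (g : C0 U) : d1 U (d0 U g) = 0 := by
  funext p q r; ext x
  simp [d1, d0, LocallyConstant.sub_apply]

/-- Čech 1-cocycles of a cover. -/
abbrev Z1 (U : PointedCover X) : AddSubgroup (C1 U) := (d1 U).ker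

/-- First Čech cohomology of a cover: cocycles modulo coboundaries. -/
abbrev H1 (U : PointedCover X) : Type u := Z1 U ⧸ (d0 U).range.addSubgroupOf (Z1 U)

/-- Restriction of cochains to a finer cover. -/
def resC0 {U V : PointedCover X} (h : U ≤ V) : C0 U →+ C0 V where
  toFun g p := res (h p) (g p)
  map_zero' := by funext p; ext x; simp
  map_add' f g := by funext p; ext x; simp

def resC1 {U V : PointedCover X} (h : U ≤ V) : C1 U →+ C1 V where
  toFun c p q := res (inf_le_inf (h p) (h q)) (c p q)
  map_zero' := by funext p q; ext x; simp
  map_add' f g := by funext p q; ext x; simp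

theorem resC1_d0 {U V : PointedCover X} (h : U ≤ V) (g : C0 U) :
    resC1 h (d0 U g) = d0 V (resC0 h g) := rfl

theorem resC1_mem_Z1 {U V : PointedCover X} (h : U ≤ V) {c : C1 U} (hc : c ∈ Z1 U) :
    resC1 h c ∈ Z1 V := by
  rw [AddMonoidHom.mem_ker] at hc ⊢
  funext p q r; ext x
  have := DFunLike.congr_fun (congrFun (congrFun (congrFun hc p) q) r)
    ⟨x.1, ⟨⟨h p x.2.1.1, h q x.2.1.2⟩, h r x.2.2⟩⟩
  exact this

def resZ1 {U V : PointedCover X} (h : U ≤ V) : Z1 U →+ Z1 V :=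
  ((resC1 h).comp (Z1 U).subtype).codRestrict (Z1 V) fun c => resC1_mem_Z1 h c.2

def resH1 (U V : PointedCover X) (h : U ≤ V) : H1 U →+ H1 V :=
  QuotientAddGroup.map _ _ (resZ1 h) (by
    rintro c ⟨g, hg⟩
    exact ⟨resC0 h g, (resC1_d0 h g).symm.trans (congrArg (resC1 h) hg)⟩)

instance : DirectedSystem (fun U : PointedCover X => H1 U) (fun U V h => resH1 U V h) where
  map_self _ x := by induction x using QuotientAddGroup.induction_on; rfl
  map_map _ _ _ _ _ x := by induction x using QuotientAddGroup.induction_on; rfl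

open Classical in
/-- The first Čech cohomology group of `X` with coefficients in `ℤ`: the direct limit, over the
open covers of `X`, of the cohomology groups of the covers. -/
abbrev CechH1 (X : Type u) [TopologicalSpace X] : Type u :=
  AddCommGroup.DirectLimit (fun U : PointedCover X => H1 U) resH1

open Classical in
/-- The class of a Čech 1-cocycle. -/
def cechClass {U : PointedCover X} (c : Z1 U) : CechH1 X :=
  AddCommGroup.DirectLimit.of (fun U : PointedCover X => H1 U) resH1 U (QuotientAddGroup.mk c)

end Cech

/-! ## Regular unbounded self-adjoint Fredholm operators -/

section Operators

variable {H : Type v} [NormedAddCommGroup H] [InnerProductSpace ℂ H]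

/-- The eigenspace of the unbounded operator `T` for the real number `lam`. -/
def eigenspace (T : H →ₗ.[ℂ] H) (lam : ℝ) : Submodule ℂ H where
  carrier := {w | ∃ h : w ∈ T.domain, T ⟨w, h⟩ = (lam : ℂ) • w}
  zero_mem' := ⟨T.domain.zero_mem, by
    rw [smul_zero]; exact T.toFun.map_zero⟩
  add_mem' := by
    rintro a b ⟨ha, hTa⟩ ⟨hb, hTb⟩
    refine ⟨T.domain.add_mem ha hb, ?_⟩
    rw [smul_add, ← hTa, ← hTb]
    exact T.map_add ⟨a, ha⟩ ⟨b, hb⟩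
  smul_mem' := by
    rintro c a ⟨ha, hTa⟩
    refine ⟨T.domain.smul_mem c ha, ?_⟩
    rw [smul_comm, ← hTa]
    exact T.map_smul c ⟨a, ha⟩

def IsEigenvalue (T : H →ₗ.[ℂ] H) (lam : ℝ) : Prop := eigenspace T lam ≠ ⊥

/-- The multiplicity `m(T, lam)`: the rank of the spectral projection onto the eigenspace. -/
def multiplicity (T : H →ₗ.[ℂ] H) (lam : ℝ) : ℕ := Module.finrank ℂ (eigenspace T lam)

/-- The bounded operator `R` is the inverse `(I + T²)⁻¹`: it maps `H` into the domain of `T²` and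
is a two-sided inverse of `I + T²`. -/
def IsInverseOneAddSq (T : H →ₗ.[ℂ] H) (R : H →L[ℂ] H) : Prop :=
  (∀ y, ∃ (h₁ : R y ∈ T.domain) (h₂ : T ⟨R y, h₁⟩ ∈ T.domain), R y + T ⟨T ⟨R y, h₁⟩, h₂⟩ = y) ∧
  ∀ (w : H) (h₁ : w ∈ T.domain) (h₂ : T ⟨w, h₁⟩ ∈ T.domain), R (w + T ⟨T ⟨w, h₁⟩, h₂⟩) = w

/-- The regular unbounded self-adjoint Fredholm operators: closed and self-adjoint, with
`(I + T²)⁻¹` compact, and with infinitely many positive and infinitely many negative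
eigenvalues. -/
structure IsRegular [CompleteSpace H] (T : H →ₗ.[ℂ] H) : Prop where
  isClosed : T.IsClosed
  isSelfAdjoint : IsSelfAdjoint T
  compact_inverse : ∃ R : H →L[ℂ] H, IsInverseOneAddSq T R ∧ IsCompactOperator R
  infinite_pos : {lam : ℝ | 0 < lam ∧ IsEigenvalue T lam}.Infinite
  infinite_neg : {lam : ℝ | lam < 0 ∧ IsEigenvalue T lam}.Infinite

/-- The bounded continuous functions on `ℝ` which have limits at `+∞` and at `-∞`, with the
supremum norm. -/
def BoundedWithLimits : Set (ℝ →ᵇ ℂ) :=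
  {f | (∃ a, Tendsto f atTop (𝓝 a)) ∧ ∃ b, Tendsto f atBot (𝓝 b)}

/-- `A = f(T)` in the functional calculus of a self-adjoint operator `T` with compact resolvent:
`A` is the bounded operator which multiplies the eigenvectors of `T` for `lam` by `f lam`. As the
eigenvectors of such a `T` span a dense subspace, this determines `A`. -/
def IsFunctionalCalculus (T : H →ₗ.[ℂ] H) (f : ℝ → ℂ) (A : H →L[ℂ] H) : Prop :=
  ∀ lam : ℝ, ∀ w ∈ eigenspace T lam, A w = f lam • w

open Classical in
/-- The operator `f(T)`. It exists whenever `T` is regular and `f` is bounded; the value `0` is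
used otherwise. -/
def functionalCalculus (T : H →ₗ.[ℂ] H) (f : ℝ → ℂ) : H →L[ℂ] H :=
  if h : ∃ A, IsFunctionalCalculus T f A then h.choose else 0

end Operators

/-! ## Families, spectral exhaustions and spectral flow -/

section Families

variable {X : Type u} [TopologicalSpace X]
variable {H : Type v} [NormedAddCommGroup H] [InnerProductSpace ℂ H]

/-- Continuity of a family of operators: `(f, x) ↦ f(D_x)` is continuous for the operator norm. -/
def IsContinuousFamily (D : X → H →ₗ.[ℂ] H) : Prop :=
  Continuous fun a : BoundedWithLimits × X => functionalCalculus (D a.2) (a.1 : ℝ →ᵇ ℂ)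

/-- The spectral graph of a family. -/
def spectralGraph (D : X → H →ₗ.[ℂ] H) : Set (X × ℝ) := {a | IsEigenvalue (D a.1) a.2}

/-- `mu` is a spectral exhaustion for the family `D`. -/
structure IsSpectralExhaustion (D : X → H →ₗ.[ℂ] H) (mu : ℤ → X → ℝ) : Prop where
  continuous : ∀ n, Continuous (mu n)
  isEigenvalue : ∀ n x, IsEigenvalue (D x) (mu n x)
  /-- every eigenvalue is listed as often as its multiplicity says -/
  exhausts : ∀ x lam, IsEigenvalue (D x) lam →
    {n : ℤ | mu n x = lam}.encard = multiplicity (D x) lam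
  monotone : ∀ n x, mu n x ≤ mu (n + 1) x

/-- A choice, for each point `p`, of a spectral exhaustion over an open neighbourhood of `p`. -/
structure LocalExhaustions (D : X → H →ₗ.[ℂ] H) where
  cover : PointedCover X
  mu : ∀ p, ℤ → cover.nhd p → ℝ
  isSpectralExhaustion : ∀ p, IsSpectralExhaustion (fun x : cover.nhd p => D x) (mu p)

/-- `c` is the cocycle of the local exhaustions `S`: on the overlap of the neighbourhoods of `p`
and `q`, the two exhaustions differ by the translation by the integer `c p q`. -/
def LocalExhaustions.HasCocycle {D : X → H →ₗ.[ℂ] H} (S : LocalExhaustions D)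
    (c : Z1 S.cover) : Prop :=
  ∀ (p q x : X) (hp : x ∈ S.cover.nhd p) (hq : x ∈ S.cover.nhd q) (n : ℤ),
    S.mu p n ⟨x, hp⟩ = S.mu q (n + c.1 p q ⟨x, hp, hq⟩) ⟨x, hq⟩

/-- `s` is the Čech class of the cocycle of some choice of local exhaustions. -/
def IsSpectralFlow (D : X → H →ₗ.[ℂ] H) (s : CechH1 X) : Prop :=
  ∃ (S : LocalExhaustions D) (c : Z1 S.cover), S.HasCocycle c ∧ s = cechClass c

open Classical in
/-- The spectral flow of a family, a class in the first Čech cohomology of `X`. For a continuous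
family of regular operators local exhaustions exist, they have a unique cocycle, and its class does
not depend on the choices; the value `0` is used for families without local exhaustions. -/
def spectralFlow (D : X → H →ₗ.[ℂ] H) : CechH1 X :=
  if h : ∃ s, IsSpectralFlow D s then h.choose else 0

end Families

end SpectralFamily

end

/-! At a fixed point, an exhaustion is a nondecreasing sequence taking each value exactly `k` times:
a staircase with steps of width `k`, whose jump positions form one residue class mod `k`. A jump at
`m` is an open condition on `x`. Having no jump at `a` means having one at one of the `k - 1`
preceding positions, which is open too. On a connected space the jump positions are therefore
constant (`exists_forall_jump`), and the exhaustion splits into `k`-fold repetitions of functions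
`nu j` that are strictly increasing in `j`. Inside `Γ` the graph of `nu j` is the part strictly
between `nu (j - 1)` and `nu (j + 1)`, hence clopen. As a copy of `X` it is connected, so it is a
component.

A global exhaustion comes from vanishing spectral flow. As `spectralFlow` has default value `0`,
local exhaustions must be shown to exist before the hypothesis says anything
(`exists_isSpectralFlow`). Constant multiplicity prevents eigenvalues from splitting
(`eventually_eigenvalue_unique_near`), so they form a discrete set moving continuously and can be
enumerated locally. Trivialising the cocycle on a finer cover makes the index shifts that glue the
local exhaustions. -/

namespace SpectralFamily

/-! ### Spectral theory of a single operator with compact resolvent -/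

section Operator

variable {H : Type*} [NormedAddCommGroup H] [InnerProductSpace ℂ H] {T : H →ₗ.[ℂ] H}

theorem exists_mem_eigenspace_ne_zero {lam : ℝ} (h : IsEigenvalue T lam) :
    ∃ w ∈ eigenspace T lam, w ≠ 0 :=
  Submodule.exists_mem_ne_zero_of_ne_bot h

theorem isEigenvalue_of_mem {lam : ℝ} {w : H} (hw : w ∈ eigenspace T lam) (h0 : w ≠ 0) :
    IsEigenvalue T lam := fun h => h0 (by rwa [h, Submodule.mem_bot] at hw)

theorem IsInverseOneAddSq.apply_of_mem_eigenspace {R : H →L[ℂ] H}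
    (hR : IsInverseOneAddSq T R) {lam : ℝ} {w : H} (hw : w ∈ eigenspace T lam) :
    R w = ((1 + lam ^ 2 : ℝ) : ℂ)⁻¹ • w := by
  obtain ⟨h, hTw⟩ := hw
  have h₂ : T ⟨w, h⟩ ∈ T.domain := by rw [hTw]; exact T.domain.smul_mem _ h
  have hTT : T ⟨T ⟨w, h⟩, h₂⟩ = ((lam ^ 2 : ℝ) : ℂ) • w := by
    have : (⟨T ⟨w, h⟩, h₂⟩ : T.domain) = (lam : ℂ) • ⟨w, h⟩ := Subtype.ext hTw
    rw [this, T.map_smul, hTw, smul_smul]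
    push_cast; ring_nf
  have key := hR.2 w h h₂
  rw [hTT] at key
  have hne : ((1 + lam ^ 2 : ℝ) : ℂ) ≠ 0 := by
    exact_mod_cast (by positivity : (1 + lam ^ 2 : ℝ) ≠ 0)
  rw [eq_inv_smul_iff₀ hne, ← map_smul, ← key]
  congr 1
  rw [key]
  push_cast
  rw [add_smul, one_smul]

variable [CompleteSpace H]

theorem inner_apply_left_of_isSelfAdjoint (hT : IsSelfAdjoint T) (x y : T.domain) :
    inner ℂ (T x) (y : H) = inner ℂ (x : H) (T y) := by
  have h := LinearPMap.adjoint_isFormalAdjoint (T := T) hT.dense_domain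
  rw [LinearPMap.isSelfAdjoint_def.mp hT] at h
  exact h x y

theorem inner_eq_zero_of_mem_eigenspace (hT : IsSelfAdjoint T) {l m : ℝ} (hlm : l ≠ m)
    {v w : H} (hv : v ∈ eigenspace T l) (hw : w ∈ eigenspace T m) : inner ℂ v w = 0 := by
  obtain ⟨hv, hTv⟩ := hv
  obtain ⟨hw, hTw⟩ := hw
  have h := inner_apply_left_of_isSelfAdjoint hT ⟨v, hv⟩ ⟨w, hw⟩
  rw [hTv, hTw, inner_smul_left, inner_smul_right, Complex.conj_ofReal] at h
  have h' : ((l : ℂ) - m) * inner ℂ v w = 0 := by rw [sub_mul, h, sub_self]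
  rcases mul_eq_zero.mp h' with h' | h'
  · exact absurd (by exact_mod_cast sub_eq_zero.mp h') hlm
  · exact h'

/-- Both sides equal `⟨Ry, Rz⟩ + ⟨TRy, TRz⟩`. -/
theorem IsInverseOneAddSq.isSymmetric (hT : IsSelfAdjoint T) {R : H →L[ℂ] H}
    (hR : IsInverseOneAddSq T R) : (R : H →ₗ[ℂ] H).IsSymmetric := by
  intro y z
  obtain ⟨hy₁, hy₂, hy⟩ := hR.1 y
  obtain ⟨hz₁, hz₂, hz⟩ := hR.1 z
  have h₁ := inner_apply_left_of_isSelfAdjoint hT ⟨R y, hy₁⟩ ⟨_, hz₂⟩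
  have h₂ := inner_apply_left_of_isSelfAdjoint hT ⟨_, hy₂⟩ ⟨R z, hz₁⟩
  change inner ℂ (R y) z = inner ℂ y (R z)
  conv_lhs => rw [← hz]
  conv_rhs => rw [← hy]
  rw [inner_add_left, inner_add_right, ← h₁, h₂]

theorem IsRegular.finiteDimensional_eigenspace (hT : IsRegular T) (lam : ℝ) :
    FiniteDimensional ℂ (eigenspace T lam) := by
  obtain ⟨R, hR, hRc⟩ := hT.compact_inverse
  have hne : ((1 + lam ^ 2 : ℝ) : ℂ) ≠ 0 := by
    exact_mod_cast (by positivity : (1 + lam ^ 2 : ℝ) ≠ 0)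
  have := ContinuousLinearMap.finite_dimensional_eigenspace hRc _ (inv_ne_zero hne)
  refine Submodule.finiteDimensional_of_le
    (S₂ := Module.End.eigenspace R.toLinearMap ((1 + lam ^ 2 : ℝ) : ℂ)⁻¹) fun w hw => ?_
  rw [Module.End.mem_eigenspace_iff]
  exact hR.apply_of_mem_eigenspace hw

theorem IsRegular.multiplicity_pos (hT : IsRegular T) {lam : ℝ} (h : IsEigenvalue T lam) :
    0 < multiplicity T lam := by
  have := hT.finiteDimensional_eigenspace lam
  have := Submodule.nontrivial_iff_ne_bot.mpr h
  exact Module.finrank_pos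

/-- The eigenvalues of a regular operator have no finite accumulation point. -/
theorem IsRegular.finite_eigenvalues (hT : IsRegular T) (M : ℝ) :
    {lam : ℝ | IsEigenvalue T lam ∧ |lam| ≤ M}.Finite := by
  by_contra hinf
  obtain ⟨R, hR, hRc⟩ := hT.compact_inverse
  have hinf : {lam : ℝ | IsEigenvalue T lam ∧ |lam| ≤ M}.Infinite := hinf
  let e := hinf.natEmbedding
  have hw : ∀ n, ∃ w ∈ eigenspace T (e n : ℝ), ‖w‖ = 1 := fun n => by
    obtain ⟨w, hw, h0⟩ := exists_mem_eigenspace_ne_zero (e n).2.1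
    refine ⟨((‖w‖⁻¹ : ℝ) : ℂ) • w, Submodule.smul_mem _ _ hw, ?_⟩
    rw [norm_smul, Complex.norm_real, norm_inv, norm_norm, inv_mul_cancel₀ (norm_ne_zero_iff.mpr h0)]
  choose w hw hw1 using hw
  have hcpt := IsCompactOperator.isCompact_closure_image_closedBall (f := (R : H →ₗ[ℂ] H)) hRc 1
  obtain ⟨a, -, φ, hφ, hlim⟩ := hcpt.tendsto_subseq (x := fun n => R (w n))
    fun n => subset_closure ⟨w n, by simp [hw1], rfl⟩
  -- The images under `R` of the orthonormal `w n` are orthogonal of norm at least `(1 + M²)⁻¹`, so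
  -- they have no Cauchy subsequence.
  have hc : 0 < (1 + M ^ 2)⁻¹ := by positivity
  obtain ⟨N, hN⟩ := Metric.cauchySeq_iff.mp hlim.cauchySeq _ hc
  have hlt := hN N le_rfl (N + 1) (Nat.le_succ N)
  have hne : (e (φ N) : ℝ) ≠ e (φ (N + 1)) := fun h =>
    (hφ (Nat.lt_succ_self N)).ne (e.injective (Subtype.ext h))
  have hort := inner_eq_zero_of_mem_eigenspace hT.isSelfAdjoint hne (hw (φ N)) (hw (φ (N + 1)))
  have hsq : ‖R (w (φ N))‖ ^ 2 ≤ ‖R (w (φ N)) - R (w (φ (N + 1)))‖ ^ 2 := by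
    rw [@norm_sub_sq ℂ, hR.apply_of_mem_eigenspace (hw (φ N)),
      hR.apply_of_mem_eigenspace (hw (φ (N + 1))), inner_smul_left, inner_smul_right, hort]
    simp
  have hle : (1 + M ^ 2)⁻¹ ≤ ‖R (w (φ N))‖ := by
    rw [hR.apply_of_mem_eigenspace (hw (φ N)), norm_smul, hw1, mul_one, norm_inv,
      Complex.norm_real, Real.norm_of_nonneg (by positivity)]
    have := sq_le_sq' (abs_le.mp (e (φ N)).2.2).1 (abs_le.mp (e (φ N)).2.2).2
    gcongr
  simp only [Function.comp_apply, dist_eq_norm] at hlt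
  have := (sq_le_sq₀ (norm_nonneg _) (norm_nonneg _)).mp hsq
  linarith

/-- The eigenvectors of a regular operator span a dense subspace. -/
theorem IsRegular.dense_iSup_eigenspace (hT : IsRegular T) :
    (⨆ lam, eigenspace T lam).topologicalClosure = ⊤ := by
  obtain ⟨R, hR, hRc⟩ := hT.compact_inverse
  have hsym := hR.isSymmetric hT.isSelfAdjoint
  rw [Submodule.topologicalClosure_eq_top_iff, eq_bot_iff, ← ContinuousLinearMap.orthogonalComplement_iSup_eigenspaces_eq_bot hRc hsym]
  -- The spectral theorem for the compact symmetric `R` reduces density to placing each eigenvector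
  -- `w` of `R` in the span of the eigenspaces of `T`.
  refine Submodule.orthogonal_le (iSup_le fun μ w hw => ?_)
  have hw : R w = μ • w := Module.End.mem_eigenspace_iff.mp hw
  obtain ⟨h₁, h₂, h⟩ := hR.1 w
  by_cases hμ : μ = 0
  · have h0 : (⟨R w, h₁⟩ : T.domain) = 0 := Subtype.ext (hw.trans (by rw [hμ, zero_smul]; rfl))
    have h0' : (⟨T ⟨R w, h₁⟩, h₂⟩ : T.domain) = 0 := Subtype.ext (by
      change T ⟨R w, h₁⟩ = 0
      rw [h0, T.map_zero])
    rw [h0', T.map_zero, hw, hμ, zero_smul, add_zero] at h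
    rw [← h]; exact Submodule.zero_mem _
  have hwd : w ∈ T.domain := by
    have := T.domain.smul_mem μ⁻¹ h₁
    rwa [hw, inv_smul_smul₀ hμ] at this
  have hTR : T ⟨R w, h₁⟩ = μ • T ⟨w, hwd⟩ := by
    rw [← T.map_smul]; congr 1; exact Subtype.ext hw
  have hwd2 : T ⟨w, hwd⟩ ∈ T.domain := by
    have := T.domain.smul_mem μ⁻¹ h₂
    rwa [hTR, inv_smul_smul₀ hμ] at this
  have hTTR : T ⟨T ⟨R w, h₁⟩, h₂⟩ = μ • T ⟨T ⟨w, hwd⟩, hwd2⟩ := by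
    rw [← T.map_smul]; congr 1; exact Subtype.ext hTR
  rw [hTTR, hw] at h
  have hTT : T ⟨T ⟨w, hwd⟩, hwd2⟩ = (μ⁻¹ - 1) • w := by
    rw [sub_smul, one_smul, eq_sub_iff_add_eq, eq_inv_smul_iff₀ hμ, smul_add, add_comm, h]
  by_cases hw0 : w = 0
  · rw [hw0]; exact Submodule.zero_mem _
  have hin := inner_apply_left_of_isSelfAdjoint hT.isSelfAdjoint ⟨w, hwd⟩ ⟨_, hwd2⟩
  simp only [hTT, inner_smul_right, inner_self_eq_norm_sq_to_K] at hin
  have hnw : ‖w‖ ≠ 0 := norm_ne_zero_iff.mpr hw0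
  -- Pairing `T²w = (μ⁻¹ - 1)w` with `w` gives `μ⁻¹ - 1 = ‖Tw‖² / ‖w‖²`.
  obtain ⟨s, hs, hs2⟩ : ∃ s : ℝ, 0 ≤ s ∧ μ⁻¹ - 1 = ((s ^ 2 : ℝ) : ℂ) := by
    refine ⟨‖T ⟨w, hwd⟩‖ / ‖w‖, by positivity, ?_⟩
    push_cast
    rw [div_pow, eq_div_iff (pow_ne_zero _ (by exact_mod_cast hnw))]
    exact hin.symm
  rw [hs2] at hTT hin
  rcases hs.eq_or_lt with rfl | hs
  · have h0 : T ⟨w, hwd⟩ = 0 := by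
      simpa using hin
    exact Submodule.mem_iSup_of_mem 0 ⟨hwd, by simpa using h0⟩
  · have hsc : (s : ℂ) ≠ 0 := by exact_mod_cast hs.ne'
    -- Since `T²w = s²w`, the vectors `±sw + Tw` lie in the eigenspaces for `±s`, and their
    -- difference is `2sw`.
    have hp : ∀ t : ℝ, (t : ℂ) ^ 2 = s ^ 2 → t • w + T ⟨w, hwd⟩ ∈ eigenspace T t := by
      intro t ht
      refine ⟨T.domain.add_mem (T.domain.smul_mem (t : ℂ) hwd) hwd2, ?_⟩
      have := T.map_add ((t : ℂ) • ⟨w, hwd⟩) ⟨_, hwd2⟩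
      rw [T.map_smul, hTT] at this
      refine this.trans ?_
      push_cast
      rw [← ht, smul_add, add_comm, sq, mul_smul]
      rfl
    have e₁ := Submodule.mem_iSup_of_mem (p := eigenspace T) s (hp s rfl)
    have e₂ := Submodule.mem_iSup_of_mem (p := eigenspace T) (-s) (hp (-s) (by push_cast; ring))
    have := Submodule.smul_mem _ (2 * s : ℂ)⁻¹ (Submodule.sub_mem _ e₁ e₂)
    convert this using 1
    rw [eq_inv_smul_iff₀ (by simpa using hsc), add_sub_add_right_eq_sub, neg_smul, sub_neg_eq_add,
      ← two_smul ℂ, mul_smul]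
    rfl

theorem IsRegular.clm_ext (hT : IsRegular T) {A B : H →L[ℂ] H}
    (h : ∀ lam, ∀ w ∈ eigenspace T lam, A w = B w) : A = B := by
  have hle : (⨆ lam, eigenspace T lam) ≤ LinearMap.eqLocus (A : H →ₗ[ℂ] H) (B : H →ₗ[ℂ] H) :=
    iSup_le fun lam w hw => h lam w hw
  have hd : Dense ((⨆ lam, eigenspace T lam : Submodule ℂ H) : Set H) :=
    (Submodule.dense_iff_topologicalClosure_eq_top).mpr hT.dense_iSup_eigenspace
  exact DFunLike.coe_injective
    (Continuous.ext_on hd A.continuous B.continuous fun w hw => hle hw)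

/-- Only finitely many eigenvalues meet the support of `f`, so a finite sum of multiples of spectral
projections works. Such `f` suffice for the stability arguments. -/
theorem IsRegular.exists_isFunctionalCalculus (hT : IsRegular T) {f : ℝ → ℂ} {M : ℝ}
    (hf : ∀ t, M < |t| → f t = 0) : ∃ A, IsFunctionalCalculus T f A := by
  have := hT.finiteDimensional_eigenspace
  refine ⟨∑ l ∈ (hT.finite_eigenvalues M).toFinset, f l • (eigenspace T l).starProjection,
    fun lam w hw => ?_⟩
  rw [sum_apply]
  have hz : ∀ l, l ≠ lam → (f l • (eigenspace T l).starProjection) w = 0 := fun l hl => by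
    rw [smul_apply,
      (Submodule.starProjection_apply_eq_zero_iff _).mpr, smul_zero]
    exact fun v hv => inner_eq_zero_of_mem_eigenspace hT.isSelfAdjoint hl hv hw
  rw [Finset.sum_eq_single lam (fun l _ hl => hz l hl), smul_apply,
    Submodule.starProjection_eq_self_iff.mpr hw]
  intro hlam
  rw [smul_apply, Submodule.starProjection_eq_self_iff.mpr hw]
  by_cases h0 : w = 0
  · rw [h0, smul_zero]
  · have : M < |lam| := by
      by_contra! h
      exact hlam ((Set.Finite.mem_toFinset _).mpr ⟨isEigenvalue_of_mem hw h0, h⟩)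
    rw [hf _ this, zero_smul]

theorem IsRegular.isFunctionalCalculus (hT : IsRegular T) {f : ℝ → ℂ} {M : ℝ}
    (hf : ∀ t, M < |t| → f t = 0) : IsFunctionalCalculus T f (functionalCalculus T f) := by
  have h := hT.exists_isFunctionalCalculus hf
  rw [functionalCalculus, dif_pos h]
  exact h.choose_spec

end Operator

/-! ### Enumerating discrete subsets of the line that move continuously -/

section Enumeration

/-- The induced map of indices is an order automorphism of `ℤ`; it preserves successors, so it is a
translation. -/
theorem strictMono_int_translate {e e' : ℤ → ℝ} (he : StrictMono e) (he' : StrictMono e')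
    (h : Set.range e = Set.range e') : ∃ d : ℤ, ∀ n, e n = e' (n + d) := by
  have hφ : ∀ n, ∃ m, e' m = e n := fun n => h.subset ⟨n, rfl⟩
  choose φ hφ using hφ
  have hmono : StrictMono φ := fun m n hmn => he'.lt_iff_lt.mp (by rw [hφ, hφ]; exact he hmn)
  have hsucc : ∀ n, φ (n + 1) = φ n + 1 := fun n => by
    obtain ⟨m, hm⟩ : ∃ m, e m = e' (φ n + 1) := h.superset ⟨_, rfl⟩
    have hm : φ m = φ n + 1 := he'.injective (by rw [hφ, hm])
    have h₁ : n < m := hmono.lt_iff_lt.mp (by omega)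
    have h₂ := hmono.monotone (Int.add_one_le_iff.mpr h₁)
    have h₃ := hmono (Int.lt_succ n)
    omega
  refine ⟨φ 0, fun n => ?_⟩
  rw [← hφ]
  congr 1
  induction n using Int.induction_on with
  | zero => simp
  | succ i hi => rw [hsucc, hi]; ring
  | pred i hi =>
    have := hsucc (-i - 1)
    rw [sub_add_cancel, hi] at this
    omega

theorem exists_strictMono_int {S : Set ℝ} (hfin : ∀ M, {l ∈ S | |l| ≤ M}.Finite)
    (habove : ∀ M, ∃ l ∈ S, M < l) (hbelow : ∀ M, ∃ l ∈ S, l < M) {l₀ : ℝ} (hl₀ : l₀ ∈ S) :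
    ∃ e : ℤ → ℝ, StrictMono e ∧ Set.range e = S ∧ e 0 = l₀ := by
  have hIcc : ∀ a b : S, (Set.Icc a b).Finite := fun a b => by
    refine Set.Finite.of_finite_image (f := Subtype.val)
      ((hfin (max |(a : ℝ)| |(b : ℝ)|)).subset ?_) Subtype.val_injective.injOn
    rintro _ ⟨l, hl, rfl⟩
    exact ⟨l.2, abs_le_max_abs_abs hl.1 hl.2⟩
  let _ : LocallyFiniteOrder S := LocallyFiniteOrder.ofFiniteIcc hIcc
  let _ : SuccOrder S := LinearLocallyFiniteOrder.succOrder S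
  let _ : PredOrder S := LinearLocallyFiniteOrder.predOrder S
  have : NoMaxOrder S := ⟨fun a => by
    obtain ⟨l, hl, h⟩ := habove a
    exact ⟨⟨l, hl⟩, h⟩⟩
  have : NoMinOrder S := ⟨fun a => by
    obtain ⟨l, hl, h⟩ := hbelow a
    exact ⟨⟨l, hl⟩, h⟩⟩
  have : Nonempty S := ⟨⟨l₀, hl₀⟩⟩
  let E : S ≃o ℤ := orderIsoIntOfLinearSuccPredArch
  refine ⟨fun n => E.symm (n + E ⟨l₀, hl₀⟩), fun m n hmn => ?_, ?_, ?_⟩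
  · exact E.symm.strictMono (by simpa using hmn)
  · ext l
    constructor
    · rintro ⟨n, rfl⟩
      exact Subtype.property _
    · intro hl
      exact ⟨E ⟨l, hl⟩ - E ⟨l₀, hl₀⟩, by simp⟩
  · simp

variable {X : Type*} [TopologicalSpace X]

/-- A family of discrete subsets of `ℝ`, unbounded on both sides, whose points move continuously
without meeting each other. -/
structure IsContinuousDiscreteFamily (S : X → Set ℝ) : Prop where
  finite : ∀ x M, {l ∈ S x | |l| ≤ M}.Finite
  above : ∀ x M, ∃ l ∈ S x, M < l
  below : ∀ x M, ∃ l ∈ S x, l < M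
  exists_near : ∀ x₀, ∀ l₀ ∈ S x₀, ∀ ε > 0, ∀ᶠ x in 𝓝 x₀, ∃ l ∈ S x, |l - l₀| < ε
  unique_near : ∀ x₀, ∀ l₀ ∈ S x₀, ∃ ε > 0, ∀ᶠ x in 𝓝 x₀, ∀ l ∈ S x, ∀ l' ∈ S x,
    |l - l₀| < ε → |l' - l₀| < ε → l = l'
  gap : ∀ x₀ a b, a < b → (∀ l ∈ S x₀, l ∉ Set.Icc a b) →
    ∀ᶠ x in 𝓝 x₀, ∀ l ∈ S x, l ∉ Set.Icc a b

namespace IsContinuousDiscreteFamily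

variable {S : X → Set ℝ}

theorem comp (hS : IsContinuousDiscreteFamily S) {Y : Type*} [TopologicalSpace Y] {φ : Y → X}
    (hφ : Continuous φ) : IsContinuousDiscreteFamily (S ∘ φ) where
  finite y := hS.finite (φ y)
  above y := hS.above (φ y)
  below y := hS.below (φ y)
  exists_near y l hl ε hε := (hφ.tendsto y).eventually (hS.exists_near _ l hl ε hε)
  unique_near y l hl := by
    obtain ⟨ε, hε, h⟩ := hS.unique_near _ l hl
    exact ⟨ε, hε, (hφ.tendsto y).eventually h⟩
  gap y a b hab h := (hφ.tendsto y).eventually (hS.gap _ a b hab h)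

theorem neg (hS : IsContinuousDiscreteFamily S) :
    IsContinuousDiscreteFamily fun x => Neg.neg ⁻¹' S x where
  finite x M := by
    refine ((hS.finite x M).preimage (neg_injective.injOn)).subset fun l hl => ?_
    exact ⟨hl.1, by simpa using hl.2⟩
  above x M := by
    obtain ⟨l, hl, h⟩ := hS.below x (-M)
    exact ⟨-l, by simpa using hl, by linarith⟩
  below x M := by
    obtain ⟨l, hl, h⟩ := hS.above x (-M)
    exact ⟨-l, by simpa using hl, by linarith⟩
  exists_near x l hl ε hε := by
    filter_upwards [hS.exists_near x _ hl ε hε] with y ⟨l', hl', h⟩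
    refine ⟨-l', by simpa using hl', ?_⟩
    rwa [abs_sub_comm, sub_neg_eq_add, add_comm, ← sub_neg_eq_add]
  unique_near x l hl := by
    obtain ⟨ε, hε, h⟩ := hS.unique_near x _ hl
    refine ⟨ε, hε, h.mono fun y hy l₁ h₁ l₂ h₂ hd₁ hd₂ => neg_injective ?_⟩
    refine hy _ h₁ _ h₂ ?_ ?_
    · rwa [← neg_sub', abs_neg]
    · rwa [← neg_sub', abs_neg]
  gap x a b hab h := by
    refine (hS.gap x (-b) (-a) (neg_lt_neg hab) fun l hl hm => ?_).mono fun y hy l hl hm => ?_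
    · exact h (-l) (by simpa using hl) ⟨by linarith [hm.2], by linarith [hm.1]⟩
    · exact hy _ hl ⟨by linarith [hm.2], by linarith [hm.1]⟩

/-- A point of `S x` near `g x₀` bounds `g x` from above. From below, `gap` keeps `g x` out of the
middle of the interval from `f x₀` to `g x₀`, and `unique_near` forbids a second point beside `f x`.
-/
theorem continuous_next (hS : IsContinuousDiscreteFamily S) {f g : X → ℝ} (hf : Continuous f)
    (hfS : ∀ x, f x ∈ S x) (hgS : ∀ x, g x ∈ S x) (hfg : ∀ x, f x < g x)
    (hnext : ∀ x, ∀ l ∈ S x, f x < l → g x ≤ l) : Continuous g := by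
  refine continuous_iff_continuousAt.mpr fun x₀ => Metric.tendsto_nhds.mpr fun ε hε => ?_
  obtain ⟨ε₁, hε₁, huniq⟩ := hS.unique_near x₀ _ (hfS x₀)
  obtain ⟨δ, hδ, hδ₁, hδ₂, hδ₃⟩ : ∃ δ > 0, δ < ε₁ ∧ δ < ε ∧ 2 * δ < g x₀ - f x₀ := by
    have h := sub_pos.mpr (hfg x₀)
    refine ⟨min ε₁ (min ε (g x₀ - f x₀)) / 3, by positivity, ?_, ?_, ?_⟩
    · linarith [min_le_left ε₁ (min ε (g x₀ - f x₀))]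
    · linarith [min_le_right ε₁ (min ε (g x₀ - f x₀)), min_le_left ε (g x₀ - f x₀)]
    · linarith [min_le_right ε₁ (min ε (g x₀ - f x₀)), min_le_right ε (g x₀ - f x₀)]
  have hgap := hS.gap x₀ (f x₀ + δ) (g x₀ - δ) (by linarith) fun l hl hm => by
    have := hnext x₀ l hl (by linarith [hm.1])
    linarith [hm.2]
  filter_upwards [huniq, hgap, hS.exists_near x₀ _ (hgS x₀) δ hδ,
    Metric.tendsto_nhds.mp hf.continuousAt δ hδ] with x h₁ h₂ ⟨l, hl, h₃⟩ h₄
  rw [Real.dist_eq, abs_lt] at h₄ ⊢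
  rw [abs_lt] at h₃
  have hle := hnext x l hl (by linarith)
  refine ⟨?_, by linarith⟩
  by_contra! hlt
  have hlt' : g x < f x₀ + δ := by
    by_contra! h
    exact h₂ _ (hgS x) ⟨h, by linarith⟩
  have := h₁ _ (hfS x) _ (hgS x) (abs_lt.mpr ⟨by linarith, by linarith⟩)
    (abs_lt.mpr ⟨by linarith [hfg x], by linarith⟩)
  exact (hfg x).ne this

theorem continuous_prev (hS : IsContinuousDiscreteFamily S) {f g : X → ℝ} (hf : Continuous f)
    (hfS : ∀ x, f x ∈ S x) (hgS : ∀ x, g x ∈ S x) (hfg : ∀ x, g x < f x)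
    (hprev : ∀ x, ∀ l ∈ S x, l < f x → l ≤ g x) : Continuous g := by
  have := hS.neg.continuous_next (f := fun x => -f x) (g := fun x => -g x) hf.neg
    (fun x => by simpa using hfS x) (fun x => by simpa using hgS x)
    (fun x => neg_lt_neg (hfg x))
    fun x l hl h => by linarith [hprev x _ hl (by linarith)]
  exact (continuous_congr fun x => neg_neg (g x)).mp this.neg

/-- Once `f` has index `0` at every point, continuity spreads from each index to its neighbours. -/
theorem exists_enumeration (hS : IsContinuousDiscreteFamily S) {f : X → ℝ} (hf : Continuous f)
    (hfS : ∀ x, f x ∈ S x) : ∃ nu : ℤ → X → ℝ, (∀ n, Continuous (nu n)) ∧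
      ∀ x, (StrictMono fun n => nu n x) ∧ (Set.range fun n => nu n x) = S x := by
  choose e hmono hrange h0 using fun x =>
    exists_strictMono_int (hS.finite x) (hS.above x) (hS.below x) (hfS x)
  have hmem : ∀ x n, e x n ∈ S x := fun x n => hrange x ▸ Set.mem_range_self n
  refine ⟨fun n x => e x n, fun n => ?_, fun x => ⟨hmono x, hrange x⟩⟩
  induction n using Int.induction_on with
  | zero => simpa only [h0] using hf
  | succ i hi =>
    refine hS.continuous_next hi (fun x => hmem x _) (fun x => hmem x _)
      (fun x => hmono x (Int.lt_succ _)) fun x l hl hlt => ?_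
    rw [← hrange x] at hl
    obtain ⟨m, rfl⟩ := hl
    exact (hmono x).monotone (Int.add_one_le_iff.mpr ((hmono x).lt_iff_lt.mp hlt))
  | pred i hi =>
    refine hS.continuous_prev hi (fun x => hmem x _) (fun x => hmem x _)
      (fun x => hmono x (Int.sub_one_lt_iff.mpr le_rfl)) fun x l hl hlt => ?_
    rw [← hrange x] at hl
    obtain ⟨m, rfl⟩ := hl
    exact (hmono x).monotone (Int.le_sub_one_iff.mpr ((hmono x).lt_iff_lt.mp hlt))

theorem exists_local_section (hS : IsContinuousDiscreteFamily S) (p : X) :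
    ∃ V : Opens X, p ∈ V ∧ ∃ f : V → ℝ, Continuous f ∧ ∀ x : V, f x ∈ S x := by
  obtain ⟨l₀, hl₀, -⟩ := hS.above p 0
  obtain ⟨ε, hε, huniq⟩ := hS.unique_near p l₀ hl₀
  obtain ⟨V, hV, hVo, hpV⟩ := eventually_nhds_iff.mp (huniq.and (hS.exists_near p l₀ hl₀ ε hε))
  choose f hfS hf using fun x : V => (hV x x.2).2
  refine ⟨⟨V, hVo⟩, hpV, f, ?_, hfS⟩
  refine continuous_iff_continuousAt.mpr fun x₀ => Metric.tendsto_nhds.mpr fun δ hδ => ?_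
  -- The margin `ε - |f x₀ - l₀|` keeps the nearby point within the window where `S x` has only one
  -- point, so it must be `f x`.
  have h := continuous_subtype_val.continuousAt.eventually (hS.exists_near x₀ _ (hfS x₀)
    (min δ (ε - |f x₀ - l₀|)) (lt_min hδ (sub_pos.mpr (hf x₀))))
  filter_upwards [h] with x ⟨l, hl, hlt⟩
  have : f x = l := (hV x x.2).1 _ (hfS x) _ hl (hf x) (by
    have := abs_sub_le l (f x₀) l₀
    linarith [min_le_right δ (ε - |f x₀ - l₀|)])
  rw [this, Real.dist_eq]
  exact hlt.trans_le (min_le_left _ _)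

theorem exists_local_enumeration (hS : IsContinuousDiscreteFamily S) (p : X) :
    ∃ V : Opens X, p ∈ V ∧ ∃ nu : ℤ → V → ℝ, (∀ n, Continuous (nu n)) ∧
      ∀ x : V, (StrictMono fun n => nu n x) ∧ (Set.range fun n => nu n x) = S x := by
  obtain ⟨V, hpV, f, hf, hfS⟩ := hS.exists_local_section p
  exact ⟨V, hpV, (hS.comp continuous_subtype_val).exists_enumeration hf hfS⟩

end IsContinuousDiscreteFamily

end Enumeration

/-! ### Stability of eigenvalues under norm-continuous functional calculus -/

section Stability

theorem exists_bump (c : ℝ) {r R : ℝ} (hr : 0 < r) (hrR : r < R) :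
    ∃ f : BoundedWithLimits, (∀ t, |t - c| ≤ r → (f : ℝ →ᵇ ℂ) t = 1) ∧
      ∀ t, R ≤ |t - c| → (f : ℝ →ᵇ ℂ) t = 0 := by
  let b : ContDiffBump c := ⟨r, R, hr, hrR⟩
  have hc : Continuous fun t => (b t : ℂ) := Complex.continuous_ofReal.comp b.continuous
  have h0 : Tendsto (fun t => (b t : ℂ)) (cocompact ℝ) (𝓝 0) :=
    (b.hasCompactSupport.comp_left (g := Complex.ofReal) Complex.ofReal_zero).is_zero_at_infty
  rw [cocompact_eq_atBot_atTop, tendsto_sup] at h0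
  refine ⟨⟨BoundedContinuousFunction.ofNormedAddCommGroup (fun t => (b t : ℂ)) hc 1 fun t => ?_,
    ⟨0, h0.2⟩, ⟨0, h0.1⟩⟩, fun t ht => ?_, fun t ht => ?_⟩
  · rw [Complex.norm_real, Real.norm_of_nonneg b.nonneg]
    exact b.le_one
  · exact congrArg Complex.ofReal
      (b.one_of_mem_closedBall (by rwa [Metric.mem_closedBall, Real.dist_eq]))
  · exact congrArg Complex.ofReal (b.zero_of_le_dist (by rwa [Real.dist_eq]))

theorem eq_zero_of_lt_abs {f : ℝ → ℂ} {c R : ℝ} (hf : ∀ t, R ≤ |t - c| → f t = 0) (t : ℝ)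
    (ht : |c| + R < |t|) : f t = 0 :=
  hf t (by linarith [abs_sub_abs_le_abs_sub t c])

variable {H : Type*} [NormedAddCommGroup H] [InnerProductSpace ℂ H]
variable {X : Type*} [TopologicalSpace X] {D : X → H →ₗ.[ℂ] H}

/-- The comparison behind all three stability results: with `f` a bump function, a nonzero vector
fixed by `f(D x)` cannot be killed by a nearby `f(D x₀)`, or conversely. -/
theorem eq_zero_of_apply_eq_self {A B : H →L[ℂ] H} (h : ‖A - B‖ < 1) {w : H}
    (hA : A w = w) (hB : B w = 0) : w = 0 := by
  by_contra h0
  have hw : 0 < ‖w‖ := norm_pos_iff.mpr h0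
  have := (A - B).le_opNorm w
  rw [sub_apply, hA, hB, sub_zero] at this
  nlinarith

theorem IsContinuousFamily.eventually_norm_sub_lt (hD : IsContinuousFamily D)
    (f : BoundedWithLimits) (x₀ : X) :
    ∀ᶠ x in 𝓝 x₀, ‖functionalCalculus (D x) (f : ℝ →ᵇ ℂ)
      - functionalCalculus (D x₀) (f : ℝ →ᵇ ℂ)‖ < 1 := by
  have hc : Continuous fun x => functionalCalculus (D x) (f : ℝ →ᵇ ℂ) :=
    Continuous.comp hD (Continuous.prodMk_right f)
  have := Metric.tendsto_nhds.mp (hc.tendsto x₀) 1 one_pos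
  simpa only [dist_eq_norm] using this

variable [CompleteSpace H]

/-- Discreteness of the spectrum leaves room beyond radius `r` for a bump function to fall to `0`
without meeting an eigenvalue. -/
theorem IsRegular.exists_isolating {T : H →ₗ.[ℂ] H} (hT : IsRegular T) (c r : ℝ) :
    ∃ R > r, ∀ l, IsEigenvalue T l → |l - c| < R → |l - c| ≤ r := by
  have h : ∀ᶠ R in 𝓝[>] r, ∀ l ∈ {l : ℝ | IsEigenvalue T l ∧ |l| ≤ |c| + r + 1},
      |l - c| < R → |l - c| ≤ r := by
    refine (Set.Finite.eventually_all (hT.finite_eigenvalues _)).mpr fun l _ => ?_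
    by_cases hl : |l - c| ≤ r
    · exact Eventually.of_forall fun _ _ => hl
    · filter_upwards [Ioo_mem_nhdsGT (not_le.mp hl)] with R hR hlt
      exact absurd hlt hR.2.not_gt
  obtain ⟨R, hR, hR₁⟩ := (h.and (Ioo_mem_nhdsGT (lt_add_one r))).exists
  refine ⟨R, hR₁.1, fun l hl hlt => hR l ⟨hl, ?_⟩ hlt⟩
  linarith [abs_sub_abs_le_abs_sub l c, hR₁.2]

theorem IsRegular.functionalCalculus_eq_zero {T : H →ₗ.[ℂ] H} (hT : IsRegular T) {f : ℝ → ℂ}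
    {c R : ℝ} (hf : ∀ t, R ≤ |t - c| → f t = 0) (h : ∀ l, IsEigenvalue T l → R ≤ |l - c|) :
    functionalCalculus T f = 0 := by
  refine hT.clm_ext fun l w hw => ?_
  rw [hT.isFunctionalCalculus (eq_zero_of_lt_abs hf) l w hw, zero_apply]
  by_cases h0 : w = 0
  · rw [h0, smul_zero]
  · rw [hf l (h l (isEigenvalue_of_mem hw h0)), zero_smul]

/-- Otherwise a bump `f` at `l₀` has `f(D x) = 0`, while `f(D x₀)` fixes the eigenvectors for `l₀`.
-/
theorem eventually_exists_eigenvalue_near (hreg : ∀ x, IsRegular (D x))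
    (hD : IsContinuousFamily D) {x₀ : X} {l₀ : ℝ} (hl₀ : IsEigenvalue (D x₀) l₀) {ε : ℝ}
    (hε : 0 < ε) : ∀ᶠ x in 𝓝 x₀, ∃ l, IsEigenvalue (D x) l ∧ |l - l₀| < ε := by
  obtain ⟨f, hf₁, hf₀⟩ := exists_bump l₀ (half_pos hε) (half_lt_self hε)
  filter_upwards [hD.eventually_norm_sub_lt f x₀] with x hx
  by_contra! hno
  obtain ⟨w, hw, hw0⟩ := exists_mem_eigenspace_ne_zero hl₀
  rw [norm_sub_rev] at hx
  refine hw0 (eq_zero_of_apply_eq_self hx (w := w) ?_ ?_)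
  · rw [(hreg x₀).isFunctionalCalculus (eq_zero_of_lt_abs hf₀) l₀ w hw, hf₁ l₀ (by simp; positivity),
      one_smul]
  · rw [(hreg x).functionalCalculus_eq_zero hf₀ hno, zero_apply]

theorem eventually_not_isEigenvalue (hreg : ∀ x, IsRegular (D x))
    (hD : IsContinuousFamily D) {x₀ : X} {c r : ℝ} (hr : 0 < r)
    (h : ∀ l, IsEigenvalue (D x₀) l → r < |l - c|) :
    ∀ᶠ x in 𝓝 x₀, ∀ l, IsEigenvalue (D x) l → r < |l - c| := by
  obtain ⟨R, hrR, hR⟩ := (hreg x₀).exists_isolating c r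
  obtain ⟨f, hf₁, hf₀⟩ := exists_bump c hr hrR
  filter_upwards [hD.eventually_norm_sub_lt f x₀] with x hx l hl
  by_contra! hlr
  obtain ⟨w, hw, hw0⟩ := exists_mem_eigenspace_ne_zero hl
  refine hw0 (eq_zero_of_apply_eq_self hx (w := w) ?_ ?_)
  · rw [(hreg x).isFunctionalCalculus (eq_zero_of_lt_abs hf₀) l w hw, hf₁ l hlr, one_smul]
  · rw [(hreg x₀).functionalCalculus_eq_zero hf₀ fun m hm => ?_, zero_apply]
    by_contra! hlt
    exact (h m hm).not_ge (hR m hm hlt)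

theorem IsRegular.functionalCalculus_mem_eigenspace {T : H →ₗ.[ℂ] H} (hT : IsRegular T)
    {f : ℝ → ℂ} {c R : ℝ} (hf : ∀ t, R ≤ |t - c| → f t = 0)
    (h : ∀ l, IsEigenvalue T l → |l - c| < R → l = c) (w : H) :
    functionalCalculus T f w ∈ eigenspace T c := by
  have := hT.finiteDimensional_eigenspace c
  have hP : (eigenspace T c).starProjection ∘L functionalCalculus T f = functionalCalculus T f := by
    refine hT.clm_ext fun l v hv => ?_
    rw [ContinuousLinearMap.comp_apply, hT.isFunctionalCalculus (eq_zero_of_lt_abs hf) l v hv,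
      Submodule.starProjection_eq_self_iff]
    by_cases h0 : v = 0
    · rw [h0, smul_zero]; exact Submodule.zero_mem _
    by_cases hl : |l - c| < R
    · rw [← h l (isEigenvalue_of_mem hv h0) hl]
      exact Submodule.smul_mem _ _ hv
    · rw [hf l (not_lt.mp hl), zero_smul]; exact Submodule.zero_mem _
  rw [← hP]
  exact Submodule.starProjection_apply_mem _ _

/-- Two distinct eigenvalues near `l₀` would have eigenspaces spanning a space of dimension `2k`,
fixed by `f(D x)`. The nearby `f(D x₀)` maps it into the `k`-dimensional eigenspace for `l₀`, so it
kills a nonzero vector. -/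
theorem eventually_eigenvalue_unique_near (hreg : ∀ x, IsRegular (D x))
    (hD : IsContinuousFamily D) {k : ℕ}
    (hk : ∀ a ∈ spectralGraph D, multiplicity (D a.1) a.2 = k) {x₀ : X} {l₀ : ℝ}
    (hl₀ : IsEigenvalue (D x₀) l₀) :
    ∃ ε > 0, ∀ᶠ x in 𝓝 x₀, ∀ l, IsEigenvalue (D x) l → ∀ l', IsEigenvalue (D x) l' →
      |l - l₀| < ε → |l' - l₀| < ε → l = l' := by
  obtain ⟨R, hR₀, hR⟩ := (hreg x₀).exists_isolating l₀ 0
  have hR' : ∀ l, IsEigenvalue (D x₀) l → |l - l₀| < R → l = l₀ := fun l hl hlt =>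
    sub_eq_zero.mp (abs_nonpos_iff.mp (hR l hl hlt))
  obtain ⟨f, hf₁, hf₀⟩ := exists_bump l₀ (half_pos hR₀) (half_lt_self hR₀)
  refine ⟨R / 2, half_pos hR₀, ?_⟩
  filter_upwards [hD.eventually_norm_sub_lt f x₀] with x hx l hl l' hl' hd hd'
  by_contra hne
  have h₁ := (hreg x).finiteDimensional_eigenspace l
  have h₂ := (hreg x).finiteDimensional_eigenspace l'
  have h₃ := (hreg x₀).finiteDimensional_eigenspace l₀
  have hdis : eigenspace (D x) l ⊓ eigenspace (D x) l' = ⊥ := by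
    refine eq_bot_iff.mpr fun w hw => ?_
    exact inner_self_eq_zero.mp
      (inner_eq_zero_of_mem_eigenspace (hreg x).isSelfAdjoint hne hw.1 hw.2)
  have hrank := Submodule.finrank_sup_add_finrank_inf_eq (eigenspace (D x) l) (eigenspace (D x) l')
  rw [hdis, finrank_bot, add_zero] at hrank
  have hm := hk (x, l) hl
  have hm' := hk (x, l') hl'
  have hm₀ := hk (x₀, l₀) hl₀
  have hpos : 0 < k := by
    rw [← hm₀]
    exact (hreg x₀).multiplicity_pos hl₀
  simp only [multiplicity] at hm hm' hm₀
  let A : ↥(eigenspace (D x) l ⊔ eigenspace (D x) l') →ₗ[ℂ] eigenspace (D x₀) l₀ :=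
    LinearMap.codRestrict _ ((functionalCalculus (D x₀) (f : ℝ →ᵇ ℂ)).toLinearMap ∘ₗ
      Submodule.subtype _) fun w => (hreg x₀).functionalCalculus_mem_eigenspace hf₀ hR' w
  have hker : LinearMap.ker A ≠ ⊥ := LinearMap.ker_ne_bot_of_finrank_lt (by omega)
  obtain ⟨w, hw, hw0⟩ := Submodule.exists_mem_ne_zero_of_ne_bot hker
  have hfix : ∀ v ∈ eigenspace (D x) l ⊔ eigenspace (D x) l',
      functionalCalculus (D x) (f : ℝ →ᵇ ℂ) v = v := by
    intro v hv
    obtain ⟨u, hu, u', hu', rfl⟩ := Submodule.mem_sup.mp hv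
    have hfc := (hreg x).isFunctionalCalculus (eq_zero_of_lt_abs hf₀)
    rw [map_add, hfc l u hu, hfc l' u' hu', hf₁ l hd.le, hf₁ l' hd'.le, one_smul, one_smul]
  exact hw0 (Subtype.ext (eq_zero_of_apply_eq_self hx (hfix w w.2)
    (congrArg Subtype.val (LinearMap.mem_ker.mp hw))))

theorem isContinuousDiscreteFamily (hreg : ∀ x, IsRegular (D x))
    (hD : IsContinuousFamily D) {k : ℕ}
    (hk : ∀ a ∈ spectralGraph D, multiplicity (D a.1) a.2 = k) :
    IsContinuousDiscreteFamily fun x => {l | IsEigenvalue (D x) l} where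
  finite x M := (hreg x).finite_eigenvalues M
  above x M := by
    by_contra! h
    refine (hreg x).infinite_pos (((hreg x).finite_eigenvalues M).subset fun l hl => ⟨hl.2, ?_⟩)
    rw [abs_of_pos hl.1]
    exact h l hl.2
  below x M := by
    by_contra! h
    refine (hreg x).infinite_neg (((hreg x).finite_eigenvalues (-M)).subset
      fun l hl => ⟨hl.2, ?_⟩)
    rw [abs_of_neg hl.1]
    exact neg_le_neg (h l hl.2)
  exists_near x l hl ε hε := eventually_exists_eigenvalue_near hreg hD hl hε
  unique_near x l hl := eventually_eigenvalue_unique_near hreg hD hk hl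
  gap x a b hab h := by
    have key : ∀ l, l ∉ Set.Icc a b ↔ (b - a) / 2 < |l - (a + b) / 2| := fun l => by
      rw [← not_le, not_iff_not, abs_le, Set.mem_Icc]
      constructor <;> rintro ⟨h₁, h₂⟩ <;> constructor <;> linarith
    simp only [key] at h ⊢
    exact eventually_not_isEigenvalue hreg hD (half_pos (sub_pos.mpr hab)) h

end Stability

/-! ### Local exhaustions, their cocycle, and gluing -/

section Flow

theorem encard_Ico_int (a : ℤ) (k : ℕ) : (Set.Ico a (a + k)).encard = k := by
  rw [← Finset.coe_Ico, Set.encard_coe_eq_coe_finsetCard, Int.card_Ico, add_sub_cancel_left,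
    Int.toNat_natCast]

theorem setOf_ediv_eq {k : ℕ} (hk : 0 < k) (j : ℤ) :
    {n : ℤ | n / k = j} = Set.Ico (j * k) (j * k + k) := by
  have hk : (0 : ℤ) < k := by exact_mod_cast hk
  ext n
  rw [Set.mem_ofPred_eq, Int.ediv_eq_iff_of_pos hk, Set.mem_Ico]

variable {H : Type*} [NormedAddCommGroup H] [InnerProductSpace ℂ H]
variable {X : Type*} [TopologicalSpace X] {D : X → H →ₗ.[ℂ] H}

/-- Repeating each function of a strict enumeration of the eigenvalues `k` times. -/
theorem isSpectralExhaustion_ediv {k : ℕ} (hk0 : 0 < k)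
    (hk : ∀ a ∈ spectralGraph D, multiplicity (D a.1) a.2 = k) {nu : ℤ → X → ℝ}
    (hc : ∀ n, Continuous (nu n)) (hmono : ∀ x, StrictMono fun n => nu n x)
    (hrange : ∀ x, (Set.range fun n => nu n x) = {l | IsEigenvalue (D x) l}) :
    IsSpectralExhaustion D fun n => nu (n / k) where
  continuous n := hc _
  isEigenvalue n x := (hrange x).subset ⟨_, rfl⟩
  exhausts x lam hlam := by
    obtain ⟨j, rfl⟩ := (hrange x).superset hlam
    rw [hk (x, nu j x) hlam, ← encard_Ico_int (j * k), ← setOf_ediv_eq hk0]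
    congr 1
    ext n
    exact (hmono x).injective.eq_iff
  monotone n x := (hmono x).monotone (Int.ediv_le_ediv (by exact_mod_cast hk0) (by omega))

/-- This rules out the default branch of `spectralFlow`. -/
theorem exists_isSpectralFlow [CompleteSpace H] (hreg : ∀ x, IsRegular (D x))
    (hD : IsContinuousFamily D) {k : ℕ} (hk0 : 0 < k)
    (hk : ∀ a ∈ spectralGraph D, multiplicity (D a.1) a.2 = k) : ∃ s, IsSpectralFlow D s := by
  choose V hV nu hc hnu using (isContinuousDiscreteFamily hreg hD hk).exists_local_enumeration
  have hk0' : (k : ℤ) ≠ 0 := by exact_mod_cast hk0.ne'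
  let S : LocalExhaustions D :=
    { cover := ⟨V, hV⟩
      mu := fun p n => nu p (n / k)
      isSpectralExhaustion := fun p => isSpectralExhaustion_ediv (X := V p)
        (D := fun x => D x) hk0 (fun a ha => hk (a.1, a.2) ha) (hc p) (fun x => (hnu p x).1)
        fun x => (hnu p x).2 }
  have hshift : ∀ p q, ∀ x : ↥(V p ⊓ V q), ∃ d : ℤ,
      ∀ n, nu p n ⟨x, x.2.1⟩ = nu q (n + d) ⟨x, x.2.2⟩ := fun p q x =>
    strictMono_int_translate (hnu p ⟨x, x.2.1⟩).1 (hnu q ⟨x, x.2.2⟩).1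
      ((hnu p ⟨x, x.2.1⟩).2.trans (hnu q ⟨x, x.2.2⟩).2.symm)
  choose d hd using hshift
  have hdloc : ∀ p q, IsLocallyConstant (d p q) := fun p q => by
    refine (IsLocallyConstant.iff_eventually_eq _).mpr fun x => ?_
    have hp : Continuous fun y : ↥(V p ⊓ V q) => nu p 0 ⟨y, y.2.1⟩ :=
      (hc p 0).comp (continuous_inclusion (inf_le_left : V p ⊓ V q ≤ V p))
    have hq : ∀ n, Continuous fun y : ↥(V p ⊓ V q) => nu q n ⟨y, y.2.2⟩ := fun n =>
      (hc q n).comp (continuous_inclusion (inf_le_right : V p ⊓ V q ≤ V q))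
    have h0 : ∀ y : ↥(V p ⊓ V q), nu p 0 ⟨y, y.2.1⟩ = nu q (d p q y) ⟨y, y.2.2⟩ := fun y => by
      simpa using hd p q y 0
    -- Lying strictly between the neighbours `d - 1` and `d + 1` is an open condition that
    -- determines the shift.
    have h₁ := (hq (d p q x - 1)).continuousAt.eventually_lt hp.continuousAt
      (by rw [h0]; exact (hnu q _).1 (Int.sub_one_lt_iff.mpr le_rfl))
    have h₂ := hp.continuousAt.eventually_lt (hq (d p q x + 1)).continuousAt
      (by rw [h0]; exact (hnu q _).1 (Int.lt_succ _))
    filter_upwards [h₁, h₂] with y hy₁ hy₂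
    rw [h0] at hy₁ hy₂
    have := (hnu q ⟨y, y.2.2⟩).1.lt_iff_lt.mp hy₁
    have := (hnu q ⟨y, y.2.2⟩).1.lt_iff_lt.mp hy₂
    omega
  -- A shift by `d` of the strict enumerations is a shift by `k * d` after `k`-fold repetition.
  let c : C1 S.cover := fun p q =>
    ⟨fun x => k * d p q x, (hdloc p q).comp fun n => (k : ℤ) * n⟩
  have hcocycle : c ∈ Z1 S.cover := by
    rw [AddMonoidHom.mem_ker]
    funext p q r
    ext x
    have hpq := hd p q ⟨x, x.2.1⟩ 0
    have hqr := hd q r ⟨x, x.2.1.2, x.2.2⟩ (0 + d p q ⟨x, x.2.1⟩)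
    have hpr := hd p r ⟨x, x.2.1.1, x.2.2⟩ 0
    have := (hnu r ⟨x, x.2.2⟩).1.injective (hpr.symm.trans (hpq.trans hqr))
    change (k : ℤ) * d q r ⟨x, x.2.1.2, x.2.2⟩ - k * d p r ⟨x, x.2.1.1, x.2.2⟩
      + k * d p q ⟨x, x.2.1⟩ = 0
    linear_combination -(k : ℤ) * this
  refine ⟨_, S, ⟨c, hcocycle⟩, fun p q x hp hq n => ?_, rfl⟩
  change nu p (n / k) ⟨x, hp⟩ = nu q ((n + k * d p q ⟨x, hp, hq⟩) / k) ⟨x, hq⟩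
  rw [Int.add_mul_ediv_left _ _ hk0']
  exact hd p q ⟨x, hp, hq⟩ (n / k)

/-- An element that vanishes in a direct limit already vanishes at some stage, here on a finer
cover. -/
theorem exists_coboundary_of_cechClass_eq_zero {U : PointedCover X} {c : Z1 U}
    (h : cechClass c = 0) : ∃ (V : PointedCover X) (hUV : U ≤ V) (g : C0 V),
      ∀ (p q x : X) (hp : x ∈ V.nhd p) (hq : x ∈ V.nhd q),
        c.1 p q ⟨x, hUV p hp, hUV q hq⟩ = g q ⟨x, hq⟩ - g p ⟨x, hp⟩ := by
  classical
  have : Nonempty (PointedCover X) := ⟨U⟩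
  obtain ⟨V, hUV, h0⟩ := AddCommGroup.DirectLimit.of.zero_exact _ _ h
  have h0 : (QuotientAddGroup.mk (resZ1 hUV c) : H1 V) = 0 := h0
  rw [QuotientAddGroup.eq_zero_iff] at h0
  obtain ⟨g, hg⟩ := h0
  refine ⟨V, hUV, g, fun p q x hp hq => ?_⟩
  exact (DFunLike.congr_fun (congrFun (congrFun hg p) q) ⟨x, hp, hq⟩).symm

/-- Local exhaustions whose cocycle has trivial class glue to a global one. -/
theorem exists_isSpectralExhaustion_of_cechClass_eq_zero {S : LocalExhaustions D}
    {c : Z1 S.cover} (hSc : S.HasCocycle c) (h : cechClass c = 0) :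
    ∃ mu, IsSpectralExhaustion D mu := by
  obtain ⟨V, hUV, g, hg⟩ := exists_coboundary_of_cechClass_eq_zero h
  let mu : ℤ → X → ℝ := fun n x =>
    S.mu x (n + g x ⟨x, V.mem_nhd x⟩) ⟨x, S.cover.mem_nhd x⟩
  -- The coboundary relation cancels the index shift, so near `p` the exhaustion chosen at `p`
  -- computes `mu`; continuity follows.
  have hmu : ∀ (p x : X) (hp : x ∈ V.nhd p) (n : ℤ),
      mu n x = S.mu p (n + g p ⟨x, hp⟩) ⟨x, hUV p hp⟩ := fun p x hp n => by
    rw [hSc p x x (hUV p hp) (S.cover.mem_nhd x), hg p x x hp (V.mem_nhd x)]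
    simp only [mu]
    congr 1
    ring
  refine ⟨mu, fun n => ?_, fun n x => (S.isSpectralExhaustion x).isEigenvalue _ ⟨x, _⟩,
    fun x lam hlam => ?_, fun n x => ?_⟩
  · refine continuous_iff_continuousAt.mpr fun p => ?_
    refine ContinuousOn.continuousAt (s := V.nhd p) ?_ ((V.nhd p).isOpen.mem_nhds (V.mem_nhd p))
    rw [continuousOn_iff_continuous_domRestrict]
    have hj : Continuous fun a : ℤ × S.cover.nhd p => S.mu p a.1 a.2 :=
      continuous_prod_of_discrete_left.mpr (S.isSpectralExhaustion p).continuous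
    have hg' : Continuous fun x : V.nhd p => n + g p x :=
      continuous_const.add (g p).continuous
    refine (hj.comp (hg'.prodMk (continuous_inclusion (hUV p)))).congr fun x => ?_
    exact (hmu p x x.2 n).symm
  · rw [← (S.isSpectralExhaustion x).exhausts ⟨x, S.cover.mem_nhd x⟩ lam hlam]
    exact Set.encard_congr ((Equiv.addRight (g x ⟨x, V.mem_nhd x⟩)).subtypeEquiv fun n => Iff.rfl)
  · have := (S.isSpectralExhaustion x).monotone (n + g x ⟨x, V.mem_nhd x⟩)
      ⟨x, S.cover.mem_nhd x⟩
    simp only [mu]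
    rwa [add_right_comm]

theorem exists_isSpectralExhaustion [CompleteSpace H] (hreg : ∀ x, IsRegular (D x))
    (hD : IsContinuousFamily D) {k : ℕ} (hk0 : 0 < k)
    (hk : ∀ a ∈ spectralGraph D, multiplicity (D a.1) a.2 = k) (h : spectralFlow D = 0) :
    ∃ mu, IsSpectralExhaustion D mu := by
  have hex := exists_isSpectralFlow hreg hD hk0 hk
  obtain ⟨S, c, hSc, hs⟩ := hex.choose_spec
  rw [spectralFlow, dif_pos hex] at h
  exact exists_isSpectralExhaustion_of_cechClass_eq_zero hSc (hs.symm.trans h)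

end Flow

/-! ### Jump positions of `k`-fold staircases -/

section Blocks

/-- A nondecreasing sequence whose values are all taken `k` times jumps exactly `k` steps after
each jump. -/
theorem setOf_eq_Ico_of_jump {e : ℤ → ℝ} (he : Monotone e) {k : ℕ}
    (hk : ∀ n, {m | e m = e n}.encard = k) {a : ℤ} (ha : e (a - 1) < e a) :
    {m | e m = e a} = Set.Ico a (a + k) := by
  have hsub : {m | e m = e a} ⊆ Set.Ico a (a + k) := by
    intro m hm
    have hm : e m = e a := hm
    have hle : a ≤ m := by
      by_contra! hlt
      exact (ha.trans_eq hm.symm).not_ge (he (by omega))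
    refine ⟨hle, ?_⟩
    by_contra! hlt
    have hsub : Set.Ico a (a + (k + 1 : ℕ)) ⊆ {m | e m = e a} := fun i hi => by
      refine le_antisymm ?_ (he hi.1)
      rw [← hm]
      exact he (by have := hi.2; push_cast at this; omega)
    have := Set.encard_le_encard hsub
    rw [encard_Ico_int, hk] at this
    have : k + 1 ≤ k := by exact_mod_cast this
    omega
  exact ((Set.finite_Ico a (a + k)).subset hsub).eq_of_subset_of_encard_le hsub
    (by rw [hk a, encard_Ico_int])

/-- Without a jump, the `k + 1` indices from `n - k` to `n` would share one value. -/
theorem exists_jump {e : ℤ → ℝ} (he : Monotone e) {k : ℕ}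
    (hk : ∀ n, {m | e m = e n}.encard = k) (n : ℤ) :
    ∃ a, e (a - 1) < e a ∧ a ≤ n ∧ n < a + k := by
  by_contra! hno
  have hconst : ∀ i : ℕ, i ≤ k → e (n - i) = e n := by
    intro i
    induction i with
    | zero => simp
    | succ i ih =>
      intro hi
      rw [← ih (by omega)]
      have h := hno (n - i)
      have h1 : n - ((i + 1 : ℕ) : ℤ) = n - i - 1 := by push_cast; ring
      rw [h1]
      refine le_antisymm (he (by omega)) ?_
      by_contra! hlt
      have := h hlt (by omega)
      omega
  have hsub : Set.Ico (n - k) (n - k + (k + 1 : ℕ)) ⊆ {m | e m = e n} := fun i hi => by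
    have h := hi.2
    have h' := hi.1
    have hi : i = n - ((n - i).toNat : ℕ) := by push_cast at h; omega
    rw [hi]
    exact hconst _ (by push_cast at h; omega)
  have := Set.encard_le_encard hsub
  rw [encard_Ico_int, hk] at this
  have : k + 1 ≤ k := by exact_mod_cast this
  omega

theorem jump_add {e : ℤ → ℝ} (he : Monotone e) {k : ℕ} (hk0 : 0 < k)
    (hk : ∀ n, {m | e m = e n}.encard = k) {a : ℤ} (ha : e (a - 1) < e a) :
    e (a + k - 1) < e (a + k) := by
  have h := setOf_eq_Ico_of_jump he hk ha
  have h₁ : a + k - 1 ∈ {m | e m = e a} := by rw [h]; constructor <;> omega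
  have h₂ : a + k ∉ {m | e m = e a} := by rw [h]; rintro ⟨-, h⟩; omega
  refine lt_of_le_of_ne (he (by omega)) fun heq => h₂ (heq.symm.trans h₁)

theorem not_jump {e : ℤ → ℝ} (he : Monotone e) {k : ℕ}
    (hk : ∀ n, {m | e m = e n}.encard = k) {a b : ℤ} (ha : e (a - 1) < e a)
    (hab : a < b) (hb : b < a + k) : ¬ e (b - 1) < e b := by
  have h := setOf_eq_Ico_of_jump he hk ha
  have h₁ : b - 1 ∈ {m | e m = e a} := by rw [h]; constructor <;> omega
  have h₂ : b ∈ {m | e m = e a} := by rw [h]; constructor <;> omega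
  exact fun hlt => hlt.ne (h₁.trans h₂.symm)

/-- The block containing `a - 1` starts at some `b` with `b < a ≤ b + k`; if `a < b + k`, the jump
at `a` would be inside that block. -/
theorem jump_sub {e : ℤ → ℝ} (he : Monotone e) {k : ℕ}
    (hk : ∀ n, {m | e m = e n}.encard = k) {a : ℤ} (ha : e (a - 1) < e a) :
    e (a - k - 1) < e (a - k) := by
  obtain ⟨b, hb, hba, hab⟩ := exists_jump he hk (a - 1)
  obtain rfl : b = a - k := by
    rcases lt_trichotomy a (b + k) with h | h | h
    · exact absurd ha (not_jump he hk hb (by omega) h)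
    · omega
    · omega
  exact hb

theorem jump_add_mul {e : ℤ → ℝ} (he : Monotone e) {k : ℕ} (hk0 : 0 < k)
    (hk : ∀ n, {m | e m = e n}.encard = k) {a : ℤ} (ha : e (a - 1) < e a) (j : ℤ) :
    e (a + j * k - 1) < e (a + j * k) := by
  induction j using Int.induction_on with
  | zero => simpa using ha
  | succ i hi =>
    have := jump_add he hk0 hk hi
    convert this using 2 <;> ring
  | pred i hi =>
    have := jump_sub he hk hi
    convert this using 2 <;> ring

variable {X : Type*} [TopologicalSpace X]

/-- The jumps of a continuous family of nondecreasing sequences, all of whose values are taken `k`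
times, do not depend on the point of a connected space. -/
theorem exists_forall_jump [ConnectedSpace X] {mu : ℤ → X → ℝ} (hc : ∀ n, Continuous (mu n))
    (hmono : ∀ x, Monotone fun n => mu n x) {k : ℕ}
    (hk : ∀ x n, {m | mu m x = mu n x}.encard = k) : ∃ a, ∀ x, mu (a - 1) x < mu a x := by
  obtain ⟨x₀⟩ := (inferInstance : Nonempty X)
  obtain ⟨a, ha, -⟩ := exists_jump (hmono x₀) (hk x₀) 0
  have hopen : ∀ m, IsOpen {x | mu (m - 1) x < mu m x} := fun m => isOpen_lt (hc _) (hc _)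
  -- If `a` is not a jump, its block starts at one of the `k - 1` preceding indices, so the
  -- complement is a union of open sets.
  have hcompl : {x | mu (a - 1) x < mu a x}ᶜ =
      ⋃ m ∈ Set.Ioo (a - k) a, {x | mu (m - 1) x < mu m x} := by
    ext x
    simp only [Set.mem_compl_iff, Set.mem_ofPred_eq, Set.mem_iUnion, exists_prop]
    constructor
    · intro hx
      obtain ⟨m, hm, hma, ham⟩ := exists_jump (hmono x) (hk x) a
      refine ⟨m, ⟨by omega, lt_of_le_of_ne hma ?_⟩, hm⟩
      rintro rfl
      exact hx hm
    · rintro ⟨m, hm, hjump⟩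
      exact not_jump (hmono x) (hk x) hjump hm.2 (by linarith [hm.1])
  have hclopen : IsClopen {x | mu (a - 1) x < mu a x} :=
    ⟨⟨by rw [hcompl]; exact isOpen_biUnion fun m _ => hopen m⟩, hopen a⟩
  exact ⟨a, Set.eq_univ_iff_forall.mp (hclopen.eq_univ ⟨x₀, ha⟩)⟩

end Blocks

/-! ### Connected components of the spectral graph -/

section Components

variable {X : Type*} [TopologicalSpace X] [ConnectedSpace X]

/-- The graph of `nu j` is clopen in `G`, where it is cut out by strict inequalities with its two
neighbours, and connected as a continuous image of `X`. -/
theorem connectedComponent_eq_graph {G : Set (X × ℝ)} {nu : ℤ → X → ℝ}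
    (hc : ∀ n, Continuous (nu n)) (hmono : ∀ x, StrictMono fun n => nu n x)
    (hG : ∀ x l, (x, l) ∈ G ↔ ∃ n, nu n x = l) {g : G} {j : ℤ} (hj : nu j g.1.1 = g.1.2) :
    connectedComponent g = {a : G | nu j a.1.1 = a.1.2} := by
  have hfst : Continuous fun a : G => a.1.1 := continuous_fst.comp continuous_subtype_val
  have hsnd : Continuous fun a : G => a.1.2 := continuous_snd.comp continuous_subtype_val
  refine subset_antisymm (IsClopen.connectedComponent_subset ⟨?_, ?_⟩ hj) ?_
  · exact isClosed_eq ((hc j).comp hfst) hsnd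
  · have : {a : G | nu j a.1.1 = a.1.2} =
        {a : G | nu (j - 1) a.1.1 < a.1.2} ∩ {a : G | a.1.2 < nu (j + 1) a.1.1} := by
      ext a
      obtain ⟨m, hm⟩ := (hG a.1.1 a.1.2).mp a.2
      simp only [Set.mem_ofPred_eq, Set.mem_inter_iff, ← hm, (hmono a.1.1).lt_iff_lt,
        (hmono a.1.1).injective.eq_iff]
      omega
    rw [this]
    exact (isOpen_lt ((hc _).comp hfst) hsnd).inter (isOpen_lt hsnd ((hc _).comp hfst))
  · let φ : X → G := fun x => ⟨(x, nu j x), (hG _ _).mpr ⟨j, rfl⟩⟩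
    have hφ : Continuous φ := (continuous_id.prodMk (hc j)).subtype_mk _
    have hrange : {a : G | nu j a.1.1 = a.1.2} = Set.range φ := by
      ext a
      constructor
      · intro ha
        exact ⟨a.1.1, Subtype.ext (Prod.ext rfl ha)⟩
      · rintro ⟨x, rfl⟩
        rfl
    have hpre : IsPreconnected {a : G | nu j a.1.1 = a.1.2} := by
      rw [hrange]
      exact isPreconnected_range hφ
    exact hpre.subset_connectedComponent hj

theorem isHomeomorph_connectedComponent_fst {G : Set (X × ℝ)} {nu : ℤ → X → ℝ}
    (hc : ∀ n, Continuous (nu n)) (hmono : ∀ x, StrictMono fun n => nu n x)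
    (hG : ∀ x l, (x, l) ∈ G ↔ ∃ n, nu n x = l) (g : G) :
    IsHomeomorph fun a : connectedComponent g => (a : G).1.1 := by
  obtain ⟨j, hj⟩ := (hG g.1.1 g.1.2).mp g.2
  have hcomp := connectedComponent_eq_graph hc hmono hG hj
  refine isHomeomorph_iff_exists_inverse.mpr ⟨by fun_prop, fun x =>
    ⟨⟨(x, nu j x), (hG _ _).mpr ⟨j, rfl⟩⟩, by rw [hcomp]; rfl⟩, fun a => ?_, fun x => rfl, ?_⟩
  · have ha : (a : G) ∈ {a : G | nu j a.1.1 = a.1.2} := hcomp ▸ a.2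
    exact Subtype.ext (Subtype.ext (Prod.ext rfl ha))
  · exact ((continuous_id.prodMk (hc j)).subtype_mk _).subtype_mk _

end Components

end SpectralFamily

theorem mainTheorem5
    {X : Type*} [TopologicalSpace X] [ConnectedSpace X] [LocallyPathConnectedSpace X]
    {H : Type*} [NormedAddCommGroup H] [InnerProductSpace ℂ H] [CompleteSpace H]
    [TopologicalSpace.SeparableSpace H]
    (D : X → H →ₗ.[ℂ] H)
    (hreg : ∀ x, SpectralFamily.IsRegular (D x))
    (hcont : SpectralFamily.IsContinuousFamily D)
    (k : ℕ)
    (hk : ∀ a ∈ SpectralFamily.spectralGraph D, SpectralFamily.multiplicity (D a.1) a.2 = k)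
    (hflow : SpectralFamily.spectralFlow D = 0) :
    (∃ mu : ℤ → X → ℝ, SpectralFamily.IsSpectralExhaustion D mu ∧
      (∀ m n, mu m = mu n ∨ Disjoint {a : X × ℝ | a.2 = mu m a.1} {a : X × ℝ | a.2 = mu n a.1}) ∧
      ∀ n, {m : ℤ | mu m = mu n}.encard = k) ∧
    ∀ g : SpectralFamily.spectralGraph D,
      IsHomeomorph fun a : connectedComponent g => (a : SpectralFamily.spectralGraph D).1.1 := by
  have hk0 : 0 < k := by
    obtain ⟨x⟩ := (inferInstance : Nonempty X)
    obtain ⟨l, -, hl⟩ := (hreg x).infinite_pos.nonempty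
    rw [← hk (x, l) hl]
    exact (hreg x).multiplicity_pos hl
  obtain ⟨mu, hmu⟩ := SpectralFamily.exists_isSpectralExhaustion hreg hcont hk0 hk hflow
  have hmono : ∀ x, Monotone fun n => mu n x := fun x =>
    monotone_int_of_le_succ fun n => hmu.monotone n x
  have hcard : ∀ x n, {m | mu m x = mu n x}.encard = k := fun x n => by
    rw [hmu.exhausts x _ (hmu.isEigenvalue n x), hk (x, mu n x) (hmu.isEigenvalue n x)]
  obtain ⟨a, ha⟩ := SpectralFamily.exists_forall_jump hmu.continuous hmono hcard
  -- One representative per block: by `jump_add_mul`, the blocks start at `a + j * k` over every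
  -- point of `X`.
  let nu : ℤ → X → ℝ := fun j => mu (a + j * k)
  have hjump : ∀ x j, mu (a + j * k - 1) x < nu j x := fun x j =>
    SpectralFamily.jump_add_mul (hmono x) hk0 (hcard x) (ha x) j
  have hnu : ∀ x, StrictMono fun j => nu j x := fun x =>
    strictMono_int_of_lt_succ fun j => by
      refine lt_of_le_of_lt (hmono x ?_) (hjump x (j + 1))
      have : (j + 1) * (k : ℤ) = j * k + k := by ring
      omega
  have hmunu : ∀ n, mu n = nu ((n - a) / k) := fun n => by
    funext x
    have hset := SpectralFamily.setOf_eq_Ico_of_jump (hmono x) (hcard x) (hjump x ((n - a) / k))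
    have hmem : n - a ∈ {m : ℤ | m / k = (n - a) / k} := rfl
    rw [SpectralFamily.setOf_ediv_eq hk0] at hmem
    exact hset.superset ⟨by linarith [hmem.1], by linarith [hmem.2]⟩
  -- Agreement at a single point forces the same block, and blocks do not depend on the point.
  have heq : ∀ x m n, mu m x = mu n x → mu m = mu n := fun x m n h => by
    rw [hmunu m, hmunu n] at h ⊢
    rw [(hnu x).injective h]
  refine ⟨⟨mu, hmu, fun m n => ?_, fun n => ?_⟩, ?_⟩
  · rw [or_iff_not_imp_left]
    refine fun hne => Set.disjoint_left.mpr fun b hb hb' => hne (heq b.1 m n ?_)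
    exact (Eq.symm hb).trans hb'
  · obtain ⟨x⟩ := (inferInstance : Nonempty X)
    rw [← hcard x n]
    congr 1
    ext m
    exact ⟨fun h => congrFun h x, heq x m n⟩
  · refine SpectralFamily.isHomeomorph_connectedComponent_fst (nu := nu)
      (fun j => hmu.continuous _) hnu fun x l => ⟨fun hl => ?_, ?_⟩
    · have hne : {n | mu n x = l}.encard ≠ 0 := by
        rw [hmu.exhausts x l hl, hk (x, l) hl]
        exact_mod_cast hk0.ne'
      obtain ⟨n, hn⟩ := Set.encard_ne_zero.mp hne
      exact ⟨_, (congrFun (hmunu n) x).symm.trans hn⟩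
    · rintro ⟨n, rfl⟩
      exact hmu.isEigenvalue _ x
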